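/- Let $R$ be an integral domain with quotient field $K$. For a nonzero fractional ideal $I$ of $R$ put $I^{-1}=\{x\in K : xI\subseteq R\}$, $I^v=(I^{-1})^{-1}$, and $I^t=\bigcup J^v$, the union being over all nonzero finitely generated fractional ideals $J\subseteq I$. A $t$-ideal of $R$ is a nonzero ideal $I$ of $R$ with $I^t=I$; a maximal $t$-ideal is a maximal element of the set of proper $t$-ideals of $R$; and a nonzero ideal $I$ is $t$-invertible if $(II^{-1})^t=R$. A nonzero finitely generated ideal $I$ of $R$ is $t$-super rigid if it is contained in exactly one maximal $t$-ideal of $R$ and every finitely generated ideal $J\supseteq I$ of $R$ is $t$-invertible. A maximal $t$-ideal of $R$ is $t$-super potent if it contains a $t$-super rigid ideal, and $R$ is $t$-super potent if each of its maximal $t$-ideals is $t$-super potent. Let $T$ be an integral domain, $M$ a maximal ideal of $T$, $k=T/M$, $\varphi:T\to k$ the canonical projection, $D$ a proper subring of $k$, and $R=\varphi^{-1}(D)$. Assume that $M\neq(0)$ or that $D$ is not a field. Then $R$ is $t$-super potent if and only if $D$ is $t$-super potent and not a field, and every maximal $t$-ideal of $T$ not contained in $M$ is $t$-super potent. -/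

import Mathlib

open scoped nonZeroDivisors

noncomputable section

namespace TOperation

variable {R : Type*} [CommRing R] [IsDomain R]

/-- Fractional ideals of the domain `R` inside its quotient field. -/
abbrev FracIdeal (R : Type*) [CommRing R] [IsDomain R] : Type _ :=
  FractionalIdeal R⁰ (FractionRing R)

/-- The inverse `I⁻¹ = {x ∈ K | x I ⊆ R}` of a nonzero fractional ideal `I`
(for `I = 0` the value is `0`). -/
def inverse (I : FracIdeal R) : FracIdeal R := 1 / I

theorem mem_inverse {I : FracIdeal R} (hI : I ≠ 0) {x : FractionRing R} :
    x ∈ inverse I ↔ ∀ y ∈ I, x * y ∈ (1 : FracIdeal R) :=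
  FractionalIdeal.mem_div_iff_of_ne_zero hI

/-- The `v`-operation `I ↦ (I⁻¹)⁻¹`. -/
def vClosure (I : FracIdeal R) : FracIdeal R := inverse (inverse I)

theorem inverse_ne_zero {I : FracIdeal R} (hI : I ≠ 0) : inverse I ≠ 0 := by
  obtain ⟨a, ha, h⟩ := I.isFractional
  intro h0
  have hmem : algebraMap R (FractionRing R) a ∈ inverse I := by
    rw [mem_inverse hI]
    intro y hy
    obtain ⟨r, hr⟩ := h y hy
    rw [FractionalIdeal.mem_one_iff]
    exact ⟨r, by rw [hr, Algebra.smul_def]⟩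
  rw [h0, FractionalIdeal.mem_zero_iff] at hmem
  exact nonZeroDivisors.ne_zero ha (IsFractionRing.injective R (FractionRing R) (by simpa using hmem))

theorem vClosure_mono {I J : FracIdeal R} (h : I ≤ J) : vClosure I ≤ vClosure J := by
  by_cases hI : I = 0
  · subst hI
    simp [vClosure, inverse]
  have hJ : J ≠ 0 := fun hJ => hI (le_antisymm (hJ ▸ h) (FractionalIdeal.zero_le I))
  intro x hx
  rw [vClosure, mem_inverse (inverse_ne_zero hI)] at hx
  rw [vClosure, mem_inverse (inverse_ne_zero hJ)]
  intro y hy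
  refine hx y ?_
  rw [mem_inverse hJ] at hy
  rw [mem_inverse hI]
  exact fun z hz => hy z (h hz)

/-- The `t`-operation: `I^t` is the union of `J^v` over the finitely generated fractional
ideals `J ⊆ I`. -/
def tClosure (I : FracIdeal R) : FracIdeal R :=
  ⟨{ carrier := {x | ∃ J : FracIdeal R,
        J ≤ I ∧ (J : Submodule R (FractionRing R)).FG ∧ x ∈ vClosure J}
     zero_mem' := ⟨0, FractionalIdeal.zero_le I, by simpa using Submodule.fg_bot,
        Submodule.zero_mem _⟩
     add_mem' := by
      rintro x y ⟨J₁, h₁, f₁, hx⟩ ⟨J₂, h₂, f₂, hy⟩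
      refine ⟨J₁ ⊔ J₂, sup_le h₁ h₂, ?_, ?_⟩
      · rw [FractionalIdeal.coe_sup]
        exact f₁.sup f₂
      · exact Submodule.add_mem _ (vClosure_mono le_sup_left hx) (vClosure_mono le_sup_right hy)
     smul_mem' := by
      rintro c x ⟨J, h, f, hx⟩
      exact ⟨J, h, f, Submodule.smul_mem _ c hx⟩ },
   by
    obtain ⟨a, ha, h⟩ := (vClosure I).isFractional
    refine ⟨a, ha, ?_⟩
    rintro x ⟨J, hJ, -, hx⟩
    exact h x (vClosure_mono hJ hx)⟩

theorem mem_tClosure {I : FracIdeal R} {x : FractionRing R} :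
    x ∈ tClosure I ↔ ∃ J : FracIdeal R,
      J ≤ I ∧ (J : Submodule R (FractionRing R)).FG ∧ x ∈ vClosure J :=
  Iff.rfl

/-- A (nonzero, integral) `t`-ideal of `R`. -/
def IsTIdeal (I : Ideal R) : Prop :=
  I ≠ ⊥ ∧ tClosure (I : FracIdeal R) = I

/-- A maximal `t`-ideal: a maximal element of the set of proper `t`-ideals. -/
def IsMaximalTIdeal (P : Ideal R) : Prop :=
  Maximal (fun I : Ideal R => IsTIdeal I ∧ I ≠ ⊤) P

/-- `t`-invertibility: `I ≠ 0` and `(I I⁻¹)^t = R`. -/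
def IsTInvertible (I : Ideal R) : Prop :=
  I ≠ ⊥ ∧ tClosure ((I : FracIdeal R) * inverse (I : FracIdeal R)) = 1

/-- A `t`-rigid ideal: nonzero, finitely generated, in exactly one maximal `t`-ideal. -/
def IsTRigid (I : Ideal R) : Prop :=
  I ≠ ⊥ ∧ I.FG ∧ ∃! P : Ideal R, IsMaximalTIdeal P ∧ I ≤ P

/-- A `t`-super rigid ideal: a `t`-rigid ideal `I` such that every finitely generated ideal
containing `I` is `t`-invertible. -/
def IsTSuperRigid (I : Ideal R) : Prop :=
  IsTRigid I ∧ ∀ J : Ideal R, J.FG → I ≤ J → IsTInvertible J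

/-- A maximal `t`-ideal that is `t`-super potent. -/
def IsTSuperPotentIdeal (P : Ideal R) : Prop :=
  IsMaximalTIdeal P ∧ ∃ I : Ideal R, I ≤ P ∧ IsTSuperRigid I

/-- The domain `R` is `t`-super potent if all of its maximal `t`-ideals are. -/
def IsTSuperPotentDomain (R : Type*) [CommRing R] [IsDomain R] : Prop :=
  ∀ P : Ideal R, IsMaximalTIdeal P → IsTSuperPotentIdeal P

end TOperation

/-- The pullback `R = φ⁻¹(D)` of `D ⊆ T/M` along the projection `φ : T → T/M`,
as a subring of `T`. -/
abbrev pullbackRing {T : Type*} [CommRing T] (M : Ideal T) (D : Subring (T ⧸ M)) : Subring T :=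
  D.comap (Ideal.Quotient.mk M)

end

/-! Elements of B^{-1} are fractions a/b with a, b in R, so membership in B^v is the divisibility
condition `DivisorialMem`, and t-invertibility means being principal at every maximal t-ideal
(`isTInvertible_iff`). Hence P is t-super potent iff some nonzero finitely generated I ⊆ P lies in
no other maximal t-ideal and every finitely generated J ⊇ I is principal at P
(`isTSuperPotentIdeal_iff`).

M is a common ideal of R and T, and the maximal t-ideals P of R are of two kinds. When D is not a
field, those containing M are the preimages of the maximal t-ideals of D. The others are the
contractions N ∩ R of the maximal t-ideals N of T not contained in M; N is recovered as (P :_T M),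
which is `extension P`, because an element of M outside P clears denominators between T and R.
Potency passes both ways along each correspondence: nonzero finitely generated ideals of D lift to
ideals that generate T, and finitely generated ideals of T acquire generators in R after
multiplication by an element of M.

If D is a field and M ≠ 0, then M is itself a maximal t-ideal of R. Were it t-super potent, with c
generating I at M, principality of I + (xc) for each x ∈ T would put x mod M in D, contradicting D ≠
k (`not_isField_of_isTSuperPotentDomain`). -/

namespace TOperation

/-! ### The t-operation through divisibility in a domain -/

section General

variable {R : Type*} [CommRing R]

/-- Elementwise membership `x ∈ B^v`, expressed by divisibility in `R`. -/
def DivisorialMem (B : Ideal R) (x : R) : Prop :=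
  ∀ a b : R, b ≠ 0 → (∀ j ∈ B, b ∣ a * j) → b ∣ a * x

theorem DivisorialMem.of_mem {B : Ideal R} {x : R} (hx : x ∈ B) : DivisorialMem B x :=
  fun _ _ _ h => h x hx

theorem DivisorialMem.mono {B C : Ideal R} (h : B ≤ C) {x : R} (hx : DivisorialMem B x) :
    DivisorialMem C x :=
  fun a b hb hC => hx a b hb fun j hj => hC j (h hj)

theorem DivisorialMem.trans {B C : Ideal R} (h : ∀ c ∈ C, DivisorialMem B c) {x : R}
    (hx : DivisorialMem C x) : DivisorialMem B x :=
  fun a b hb hB => hx a b hb fun c hc => h c hc a b hb hB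

theorem DivisorialMem.add {B : Ideal R} {x y : R} (hx : DivisorialMem B x)
    (hy : DivisorialMem B y) : DivisorialMem B (x + y) := fun a b hb h => by
  rw [mul_add]
  exact dvd_add (hx a b hb h) (hy a b hb h)

theorem DivisorialMem.mul_left {B : Ideal R} {x : R} (c : R) (hx : DivisorialMem B x) :
    DivisorialMem B (c * x) := fun a b hb h => by
  rw [mul_left_comm]
  exact Dvd.dvd.mul_left (hx a b hb h) c

/-- `J` becomes principal in the localization at the prime `P`, in a denominator-free form. -/
def PrincipalAt (P J : Ideal R) : Prop :=
  ∃ c ∈ J, ∃ s ∉ P, ∀ j ∈ J, c ∣ s * j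

theorem PrincipalAt.of_not_le {P J : Ideal R} (h : ¬ J ≤ P) : PrincipalAt P J := by
  obtain ⟨c, hc, hcP⟩ := SetLike.not_le_iff_exists.mp h
  exact ⟨c, hc, c, hcP, fun j _ => dvd_mul_right c j⟩

theorem algebraMap_ne_zero {b : R} (hb : b ≠ 0) : algebraMap R (FractionRing R) b ≠ 0 := by
  simpa using hb

/-- The extra generator `a` keeps B nonzero when x = 0. The condition B ≠ ⊥ matters: over a field
`DivisorialMem ⊥` holds for every element, whereas `vClosure 0 = 0`. -/
theorem exists_fg_mem {I : Ideal R} (hI : I ≠ ⊥) {x : R} (hx : x ∈ I) :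
    ∃ B ≤ I, B.FG ∧ B ≠ ⊥ ∧ DivisorialMem B x := by
  obtain ⟨a, ha, ha0⟩ := Submodule.exists_mem_ne_zero_of_ne_bot hI
  refine ⟨Ideal.span {a, x}, ?_, Submodule.fg_span (Set.toFinite _), ?_, ?_⟩
  · rw [Ideal.span_le]
    rintro y (rfl | rfl) <;> assumption
  · intro h
    exact ha0 (by simpa [h] using (Ideal.subset_span (by simp) : a ∈ Ideal.span {a, x}))
  · exact .of_mem (Ideal.subset_span (by simp))

/-- The `t`-closure of a nonzero integral ideal, as an ideal. -/
def tClosureIdeal (I : Ideal R) (hI : I ≠ ⊥) : Ideal R where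
  carrier := {x | ∃ B ≤ I, B.FG ∧ B ≠ ⊥ ∧ DivisorialMem B x}
  zero_mem' := exists_fg_mem hI (zero_mem I)
  add_mem' := by
    rintro x y ⟨B, hB, fB, nB, hx⟩ ⟨C, hC, fC, -, hy⟩
    exact ⟨B ⊔ C, sup_le hB hC, Submodule.FG.sup fB fC, fun h => nB (sup_eq_bot_iff.mp h).1,
      (hx.mono le_sup_left).add (hy.mono le_sup_right)⟩
  smul_mem' := by
    rintro c x ⟨B, hB, fB, nB, hx⟩
    exact ⟨B, hB, fB, nB, hx.mul_left c⟩

theorem mem_tClosureIdeal {I : Ideal R} (hI : I ≠ ⊥) {x : R} :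
    x ∈ tClosureIdeal I hI ↔ ∃ B ≤ I, B.FG ∧ B ≠ ⊥ ∧ DivisorialMem B x :=
  Iff.rfl

theorem le_tClosureIdeal {I : Ideal R} (hI : I ≠ ⊥) : I ≤ tClosureIdeal I hI :=
  fun _ hx => exists_fg_mem hI hx

/-- Finitely many elements of the closure share one witness B; this gives idempotence of the
t-closure. -/
theorem exists_fg_le_of_fg_le_tClosureIdeal {I : Ideal R} (hI : I ≠ ⊥) {C : Ideal R}
    (hC : C.FG) (h : C ≤ tClosureIdeal I hI) :
    ∃ B ≤ I, B.FG ∧ B ≠ ⊥ ∧ ∀ c ∈ C, DivisorialMem B c := by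
  induction C, hC using Submodule.fg_induction with
  | singleton x =>
    obtain ⟨B, hB, fB, nB, hx⟩ := h (Submodule.mem_span_singleton_self x)
    refine ⟨B, hB, fB, nB, fun c hc => ?_⟩
    obtain ⟨r, rfl⟩ := Submodule.mem_span_singleton.mp hc
    exact hx.mul_left r
  | sup C₁ C₂ _ _ h₁ h₂ =>
    obtain ⟨B₁, hB₁, f₁, n₁, hx₁⟩ := h₁ (le_sup_left.trans h)
    obtain ⟨B₂, hB₂, f₂, n₂, hx₂⟩ := h₂ (le_sup_right.trans h)
    refine ⟨B₁ ⊔ B₂, sup_le hB₁ hB₂, Submodule.FG.sup f₁ f₂, fun h => n₁ (sup_eq_bot_iff.mp h).1,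
      fun c hc => ?_⟩
    obtain ⟨y, hy, z, hz, rfl⟩ := Submodule.mem_sup.mp hc
    exact ((hx₁ y hy).mono le_sup_left).add ((hx₂ z hz).mono le_sup_right)

variable [IsDomain R]

theorem algebraMap_mem_vClosure {B : Ideal R} (hB : B ≠ ⊥) (x : R) :
    algebraMap R (FractionRing R) x ∈ vClosure (B : FracIdeal R) ↔ DivisorialMem B x := by
  have hB' : (B : FracIdeal R) ≠ 0 := FractionalIdeal.coeIdeal_ne_zero.mpr hB
  rw [vClosure, mem_inverse (inverse_ne_zero hB')]
  constructor
  · intro h a b hb hj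
    have hb' := algebraMap_ne_zero hb
    have hy : algebraMap R (FractionRing R) a / algebraMap R (FractionRing R) b ∈
        inverse (B : FracIdeal R) := by
      rw [mem_inverse hB']
      intro y hy
      obtain ⟨j, hjB, rfl⟩ := (FractionalIdeal.mem_coeIdeal _).mp hy
      obtain ⟨d, hd⟩ := hj j hjB
      rw [FractionalIdeal.mem_one_iff]
      refine ⟨d, ?_⟩
      rw [div_mul_eq_mul_div, ← map_mul, hd, map_mul, mul_div_cancel_left₀ _ hb']
    obtain ⟨d, hd⟩ := (FractionalIdeal.mem_one_iff _).mp (h _ hy)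
    refine ⟨d, IsFractionRing.injective R (FractionRing R) ?_⟩
    rw [map_mul, map_mul, hd]
    field_simp
  · intro h y hy
    rw [mem_inverse hB'] at hy
    obtain ⟨a, b, hb, rfl⟩ := IsFractionRing.div_surjective (A := R) y
    have hb0 := nonZeroDivisors.ne_zero hb
    have hb' := algebraMap_ne_zero hb0
    have := h a b hb0 (fun j hj => by
      obtain ⟨d, hd⟩ := (FractionalIdeal.mem_one_iff _).mp
        (hy _ ((FractionalIdeal.mem_coeIdeal _).mpr ⟨j, hj, rfl⟩))
      refine ⟨d, IsFractionRing.injective R (FractionRing R) ?_⟩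
      rw [map_mul, map_mul, hd]
      field_simp)
    obtain ⟨d, hd⟩ := this
    rw [FractionalIdeal.mem_one_iff]
    refine ⟨d, ?_⟩
    rw [mul_div_assoc', ← map_mul, mul_comm x a, hd, map_mul, mul_div_cancel_left₀ _ hb']

theorem vClosure_le_one {J : FracIdeal R} (hJ : J ≤ 1) : vClosure J ≤ 1 := by
  refine (vClosure_mono hJ).trans ?_
  simp [vClosure, inverse]

theorem mem_tClosure_coeIdeal {I : Ideal R} {x : R} (hI : I ≠ ⊥) :
    algebraMap R (FractionRing R) x ∈ tClosure (I : FracIdeal R) ↔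
      ∃ B ≤ I, B.FG ∧ B ≠ ⊥ ∧ DivisorialMem B x := by
  rw [mem_tClosure]
  constructor
  · rintro ⟨J, hJ, hfg, hx⟩
    obtain ⟨B, rfl⟩ := FractionalIdeal.le_one_iff_exists_coeIdeal.mp
      (hJ.trans FractionalIdeal.coeIdeal_le_one)
    -- By the convention `inverse 0 = 0`, the zero ideal contributes only x = 0, which any nonzero
    -- principal subideal of I also captures.
    by_cases hB : B = ⊥
    · subst hB
      have h0 : x = 0 := by simpa [vClosure, inverse] using hx
      obtain ⟨a, ha, ha0⟩ := Submodule.exists_mem_ne_zero_of_ne_bot hI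
      refine ⟨Ideal.span {a}, (Ideal.span_singleton_le_iff_mem _).mpr ha,
        Submodule.fg_span (Set.finite_singleton _), by simpa using ha0, ?_⟩
      rw [h0]
      exact .of_mem (zero_mem _)
    · refine ⟨B, FractionalIdeal.coeIdeal_le_coeIdeal _ |>.mp hJ, ?_, hB,
        (algebraMap_mem_vClosure hB x).mp hx⟩
      rw [FractionalIdeal.coe_coeIdeal] at hfg
      exact (IsLocalization.coeSubmodule_fg _ (IsFractionRing.injective R _) B).mp hfg
  · rintro ⟨B, hB, hfg, h0, hx⟩
    refine ⟨B, (FractionalIdeal.coeIdeal_le_coeIdeal _).mpr hB, ?_,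
      (algebraMap_mem_vClosure h0 x).mpr hx⟩
    rw [FractionalIdeal.coe_coeIdeal]
    exact (IsLocalization.coeSubmodule_fg _ (IsFractionRing.injective R _) B).mpr hfg

theorem tClosure_le_one {J : FracIdeal R} (hJ : J ≤ 1) : tClosure J ≤ 1 := by
  intro x hx
  obtain ⟨B, hB, -, hx⟩ := mem_tClosure.mp hx
  exact vClosure_le_one (hB.trans hJ) hx

theorem isTIdeal_iff {I : Ideal R} :
    IsTIdeal I ↔ I ≠ ⊥ ∧ ∀ B ≤ I, B.FG → B ≠ ⊥ → ∀ x, DivisorialMem B x → x ∈ I := by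
  refine and_congr_right fun hI => ?_
  constructor
  · intro h B hB hfg h0 x hx
    have := (mem_tClosure_coeIdeal hI).mpr ⟨B, hB, hfg, h0, hx⟩
    rw [h] at this
    obtain ⟨y, hy, hxy⟩ := (FractionalIdeal.mem_coeIdeal _).mp this
    rwa [← IsFractionRing.injective R (FractionRing R) hxy]
  · intro h
    apply le_antisymm
    · intro x hx
      obtain ⟨y, rfl⟩ := (FractionalIdeal.mem_one_iff _).mp
        (tClosure_le_one FractionalIdeal.coeIdeal_le_one hx)
      obtain ⟨B, hB, hfg, h0, hy⟩ := (mem_tClosure_coeIdeal hI).mp hx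
      exact (FractionalIdeal.mem_coeIdeal _).mpr ⟨y, h B hB hfg h0 y hy, rfl⟩
    · intro x hx
      obtain ⟨y, hy, rfl⟩ := (FractionalIdeal.mem_coeIdeal _).mp hx
      exact (mem_tClosure_coeIdeal hI).mpr (exists_fg_mem hI hy)

theorem IsTIdeal.mem {I : Ideal R} (hI : IsTIdeal I) {B : Ideal R} (hB : B ≤ I) (hfg : B.FG)
    (h0 : B ≠ ⊥) {x : R} (hx : DivisorialMem B x) : x ∈ I :=
  (isTIdeal_iff.mp hI).2 B hB hfg h0 x hx

theorem isTIdeal_span_singleton {d : R} (hd : d ≠ 0) : IsTIdeal (Ideal.span {d}) := by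
  rw [isTIdeal_iff]
  refine ⟨by simpa using hd, fun B hB _ _ x hx => ?_⟩
  rw [Ideal.mem_span_singleton]
  simpa using hx 1 d hd fun j hj => by
    simpa using Ideal.mem_span_singleton.mp (hB hj)

theorem isTIdeal_tClosureIdeal {I : Ideal R} (hI : I ≠ ⊥) : IsTIdeal (tClosureIdeal I hI) := by
  rw [isTIdeal_iff]
  refine ⟨fun h => hI (le_bot_iff.mp (h ▸ le_tClosureIdeal hI)), fun C hC fC _ x hx => ?_⟩
  obtain ⟨B, hB, fB, nB, h⟩ := exists_fg_le_of_fg_le_tClosureIdeal hI fC hC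
  exact ⟨B, hB, fB, nB, hx.trans h⟩

/-- Zorn applies because the t-operation has finite type: a finitely generated ideal inside the
union of a chain lies in one member. -/
theorem IsTIdeal.exists_le_isMaximalTIdeal {I : Ideal R} (hI : IsTIdeal I) (h1 : I ≠ ⊤) :
    ∃ P, IsMaximalTIdeal P ∧ I ≤ P := by
  suffices h : ∀ c ⊆ {I : Ideal R | IsTIdeal I ∧ I ≠ ⊤}, IsChain (· ≤ ·) c → ∀ J ∈ c,
      ∃ ub ∈ {I : Ideal R | IsTIdeal I ∧ I ≠ ⊤}, ∀ z ∈ c, z ≤ ub by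
    obtain ⟨P, hIP, hP⟩ := zorn_le_nonempty₀ _ h I ⟨hI, h1⟩
    exact ⟨P, hP, hIP⟩
  intro c hc hchain J hJ
  have hdir : DirectedOn (· ≤ ·) c := hchain.directedOn
  have hne : c.Nonempty := ⟨J, hJ⟩
  refine ⟨sSup c, ⟨isTIdeal_iff.mpr ⟨?_, ?_⟩, ?_⟩, fun K hK => le_sSup hK⟩
  · exact fun h => (hc hJ).1.1 (le_bot_iff.mp (h ▸ le_sSup hJ))
  · intro B hB fB nB x hx
    have hcomp := (Submodule.fg_iff_compact B).mp fB
    obtain ⟨K, hK, hBK⟩ := (CompleteLattice.isCompactElement_iff_le_of_directed_sSup_le _ _).mp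
      hcomp c hne hdir hB
    exact le_sSup hK ((hc hK).1.mem hBK fB nB hx)
  · intro h
    obtain ⟨K, hK, h1K⟩ := (Submodule.mem_sSup_of_directed hne hdir).mp
      ((Ideal.eq_top_iff_one _).mp h)
    exact (hc hK).2 ((Ideal.eq_top_iff_one _).mpr h1K)

theorem exists_divisorialMem_one {A : Ideal R} (hA : A ≠ ⊥) :
    (∃ B ≤ A, B.FG ∧ B ≠ ⊥ ∧ DivisorialMem B 1) ↔ ∀ P, IsMaximalTIdeal P → ¬ A ≤ P := by
  constructor
  · rintro ⟨B, hB, fB, nB, h⟩ P hP hAP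
    exact hP.1.2 ((Ideal.eq_top_iff_one _).mpr (hP.1.1.mem (hB.trans hAP) fB nB h))
  · intro h
    by_contra hcon
    obtain ⟨P, hP, hle⟩ := (isTIdeal_tClosureIdeal hA).exists_le_isMaximalTIdeal
      fun h => hcon ((mem_tClosureIdeal hA).mp ((Ideal.eq_top_iff_one _).mp h))
    exact h P hP ((le_tClosureIdeal hA).trans hle)

theorem IsMaximalTIdeal.eq_of_le {P I : Ideal R} (hP : IsMaximalTIdeal P) (hI : IsTIdeal I)
    (h1 : I ≠ ⊤) (h : P ≤ I) : P = I :=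
  Maximal.eq_of_le hP ⟨hI, h1⟩ h

/-- For x ∉ P the colon ideal (P : x) is a proper t-ideal containing P, hence equals P. -/
theorem IsMaximalTIdeal.isPrime {P : Ideal R} (hP : IsMaximalTIdeal P) : P.IsPrime := by
  refine ⟨hP.1.2, fun {x y} hxy => or_iff_not_imp_left.mpr fun hx => ?_⟩
  have hx0 : x ≠ 0 := fun h => hx (h ▸ zero_mem P)
  set Q : Ideal R := Submodule.comap (LinearMap.mulLeft R x) P with hQ
  have hmem : ∀ z, z ∈ Q ↔ x * z ∈ P := fun z => Iff.rfl
  have hle : P ≤ Q := fun z hz => P.mul_mem_left x hz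
  have hQt : IsTIdeal Q := by
    rw [isTIdeal_iff]
    refine ⟨fun h => hP.1.1.1 (le_bot_iff.mp (h ▸ hle)), fun B hB fB nB z hz => ?_⟩
    refine hP.1.1.mem (B := Submodule.map (LinearMap.mulLeft R x) B)
      (Submodule.map_le_iff_le_comap.mpr hB) (Submodule.FG.map _ fB) ?_ ?_
    · obtain ⟨b, hb, hb0⟩ := Submodule.exists_mem_ne_zero_of_ne_bot nB
      intro h
      have : x * b ∈ Submodule.map (LinearMap.mulLeft R x) B := ⟨b, hb, rfl⟩
      rw [h, Submodule.mem_bot] at this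
      exact mul_ne_zero hx0 hb0 this
    · intro a b hb h
      have := hz (a * x) b hb fun j hj => by
        simpa [mul_assoc] using h (x * j) ⟨j, hj, rfl⟩
      simpa [mul_assoc] using this
  have hQ1 : Q ≠ ⊤ := fun h => hx (by
    simpa using (hmem 1).mp ((Ideal.eq_top_iff_one _).mp h))
  rw [hP.eq_of_le hQt hQ1 hle]
  exact hxy

/-- The integral ideal A = J J^{-1} has t-closure R iff it lies in no maximal t-ideal. As P is an
ideal, A ⊄ P means that some product s = c y with c ∈ J, y ∈ J^{-1} avoids P; then y = s/c, and y J
⊆ R says that c divides sJ. -/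
theorem isTInvertible_iff {J : Ideal R} :
    IsTInvertible J ↔ J ≠ ⊥ ∧ ∀ P, IsMaximalTIdeal P → PrincipalAt P J := by
  refine and_congr_right fun hJ => ?_
  have hJ' : (J : FracIdeal R) ≠ 0 := FractionalIdeal.coeIdeal_ne_zero.mpr hJ
  have hle : (J : FracIdeal R) * inverse (J : FracIdeal R) ≤ 1 := by
    rw [FractionalIdeal.mul_le]
    intro i hi y hy
    rw [mul_comm]
    exact (mem_inverse hJ').mp hy i hi
  obtain ⟨A, hAeq⟩ := FractionalIdeal.le_one_iff_exists_coeIdeal.mp hle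
  have hA : A ≠ ⊥ := by
    rw [← FractionalIdeal.coeIdeal_ne_zero (K := FractionRing R), hAeq]
    obtain ⟨j, hj, hj0⟩ := Submodule.exists_mem_ne_zero_of_ne_bot hJ
    obtain ⟨y, hy, hy0⟩ := Submodule.exists_mem_ne_zero_of_ne_bot
      ((FractionalIdeal.coeToSubmodule_ne_bot).mpr (inverse_ne_zero hJ'))
    intro h
    have := FractionalIdeal.mul_mem_mul ((FractionalIdeal.mem_coeIdeal R⁰).mpr ⟨j, hj, rfl⟩) hy
    rw [h, FractionalIdeal.mem_zero_iff] at this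
    exact mul_ne_zero (algebraMap_ne_zero hj0) hy0 this
  have key : tClosure ((J : FracIdeal R) * inverse (J : FracIdeal R)) = 1 ↔
      ∀ P, IsMaximalTIdeal P → ¬ A ≤ P := by
    rw [← exists_divisorialMem_one hA, ← mem_tClosure_coeIdeal hA, hAeq, map_one]
    constructor
    · intro h
      rw [h]
      exact FractionalIdeal.one_mem_one _
    · intro h
      refine le_antisymm (tClosure_le_one hle) (FractionalIdeal.one_le.mpr h)
  rw [key]
  refine forall₂_congr fun P hP => ?_
  constructor
  · intro hAP
    by_contra hcon
    refine hAP ((FractionalIdeal.coeIdeal_le_coeIdeal (FractionRing R)).mp ?_)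
    rw [hAeq, FractionalIdeal.mul_le]
    intro i hi y hy
    obtain ⟨c, hc, rfl⟩ := (FractionalIdeal.mem_coeIdeal _).mp hi
    rw [mem_inverse hJ'] at hy
    obtain ⟨s, hs⟩ := (FractionalIdeal.mem_one_iff _).mp (hy _ hi)
    by_contra hsP
    refine hcon ⟨c, hc, s, fun h => hsP ?_, fun j hj => ?_⟩
    · exact (FractionalIdeal.mem_coeIdeal _).mpr ⟨s, h, by rw [hs, mul_comm]⟩
    · obtain ⟨d, hd⟩ := (FractionalIdeal.mem_one_iff _).mp
        (hy _ ((FractionalIdeal.mem_coeIdeal _).mpr ⟨j, hj, rfl⟩))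
      refine ⟨d, IsFractionRing.injective R (FractionRing R) ?_⟩
      rw [map_mul, map_mul, hs, hd]
      ring
  · rintro ⟨c, hc, s, hs, h⟩ hAP
    have hs0 : s ≠ 0 := fun h0 => hs (h0 ▸ zero_mem P)
    have hc0 : c ≠ 0 := by
      rintro rfl
      obtain ⟨j, hj, hj0⟩ := Submodule.exists_mem_ne_zero_of_ne_bot hJ
      exact mul_ne_zero hs0 hj0 (zero_dvd_iff.mp (h j hj))
    have hc' := algebraMap_ne_zero hc0
    have hmem : algebraMap R (FractionRing R) s ∈ (A : FracIdeal R) := by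
      rw [hAeq]
      have : algebraMap R (FractionRing R) s = algebraMap R (FractionRing R) c *
          (algebraMap R (FractionRing R) s / algebraMap R (FractionRing R) c) := by
        field_simp
      rw [this]
      refine FractionalIdeal.mul_mem_mul ((FractionalIdeal.mem_coeIdeal _).mpr ⟨c, hc, rfl⟩) ?_
      rw [mem_inverse hJ']
      intro y hy
      obtain ⟨j, hj, rfl⟩ := (FractionalIdeal.mem_coeIdeal _).mp hy
      obtain ⟨d, hd⟩ := h j hj
      rw [FractionalIdeal.mem_one_iff]
      refine ⟨d, ?_⟩
      rw [div_mul_eq_mul_div, ← map_mul, hd, map_mul, mul_div_cancel_left₀ _ hc']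
    obtain ⟨y, hy, hys⟩ := (FractionalIdeal.mem_coeIdeal _).mp hmem
    rw [IsFractionRing.injective R (FractionRing R) hys] at hy
    exact hs (hAP hy)

/-- Only P needs testing: at any other maximal t-ideal P', J is not contained in P' and so is
trivially principal there. -/
theorem isTSuperPotentIdeal_iff {P : Ideal R} :
    IsTSuperPotentIdeal P ↔ IsMaximalTIdeal P ∧ ∃ I ≤ P, I ≠ ⊥ ∧ I.FG ∧
      (∀ P', IsMaximalTIdeal P' → I ≤ P' → P' = P) ∧
      ∀ J : Ideal R, J.FG → I ≤ J → PrincipalAt P J := by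
  refine and_congr_right fun hP => exists_congr fun I => and_congr_right fun hI => ?_
  constructor
  · rintro ⟨⟨h0, hfg, Q, -, hQ⟩, hJ⟩
    refine ⟨h0, hfg, fun P' hP' hle => ?_, fun J fJ hle => (isTInvertible_iff.mp (hJ J fJ hle)).2 P hP⟩
    exact (hQ P' ⟨hP', hle⟩).trans (hQ P ⟨hP, hI⟩).symm
  · rintro ⟨h0, hfg, huniq, hJ⟩
    refine ⟨⟨h0, hfg, P, ⟨hP, hI⟩, fun P' h => huniq P' h.1 h.2⟩, fun J fJ hle => ?_⟩
    refine isTInvertible_iff.mpr ⟨fun h => h0 (le_bot_iff.mp (h ▸ hle)), fun P' hP' => ?_⟩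
    by_cases h : J ≤ P'
    · rw [huniq P' hP' (hle.trans h)]
      exact hJ J fJ hle
    · exact .of_not_le h

end General

/-! ### The pullback ring: passage between R, D and T -/

section Pullback

variable {T : Type*} [CommRing T] {M : Ideal T} {D : Subring (T ⧸ M)}

theorem mem_pullbackRing_of_mem {x : T} (hx : x ∈ M) : x ∈ pullbackRing M D := by
  rw [Subring.mem_comap, Ideal.Quotient.eq_zero_iff_mem.mpr hx]
  exact zero_mem D

theorem pullbackRing_dvd {a b : pullbackRing M D} {y : T} (hy : y ∈ pullbackRing M D)
    (h : (b : T) = a * y) : a ∣ b :=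
  ⟨⟨y, hy⟩, Subtype.ext h⟩

variable (M D) in
/-- The projection `R → D` of the pullback. -/
def pullbackMap : pullbackRing M D →+* D :=
  (Ideal.Quotient.mk M).restrict (pullbackRing M D) D fun _ hx => hx

theorem coe_pullbackMap (x : pullbackRing M D) :
    (pullbackMap M D x : T ⧸ M) = Ideal.Quotient.mk M x :=
  rfl

theorem pullbackMap_surjective : Function.Surjective (pullbackMap M D) := by
  rintro ⟨z, hz⟩
  obtain ⟨x, rfl⟩ := Ideal.Quotient.mk_surjective z
  exact ⟨⟨x, hz⟩, rfl⟩

theorem pullbackMap_eq_zero_iff {x : pullbackRing M D} : pullbackMap M D x = 0 ↔ (x : T) ∈ M := by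
  rw [← Ideal.Quotient.eq_zero_iff_mem, ← coe_pullbackMap, ZeroMemClass.coe_eq_zero]

theorem mem_ker_pullbackMap {x : pullbackRing M D} :
    x ∈ RingHom.ker (pullbackMap M D) ↔ (x : T) ∈ M :=
  pullbackMap_eq_zero_iff

theorem comap_map_pullbackMap {P : Ideal (pullbackRing M D)}
    (hP : RingHom.ker (pullbackMap M D) ≤ P) :
    (P.map (pullbackMap M D)).comap (pullbackMap M D) = P := by
  rw [Ideal.comap_map_of_surjective' _ pullbackMap_surjective, sup_eq_left]
  exact hP

theorem ker_le_comap (Q : Ideal D) :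
    RingHom.ker (pullbackMap M D) ≤ Q.comap (pullbackMap M D) :=
  Ideal.comap_mono bot_le

theorem exists_fg_map_eq {C : Ideal D} (hC : C.FG) :
    ∃ B : Ideal (pullbackRing M D), B.FG ∧ B.map (pullbackMap M D) = C := by
  obtain ⟨S, rfl⟩ := hC
  refine ⟨Ideal.span (Function.surjInv pullbackMap_surjective '' (S : Set D)),
    Submodule.fg_span (S.finite_toSet.image _), ?_⟩
  rw [Ideal.map_span, Set.image_image]
  simp [Function.surjInv_eq]

theorem dvd_mul_of_mem_map {B : Ideal (pullbackRing M D)} {a b : pullbackRing M D}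
    (h : ∀ j ∈ B, b ∣ a * j) {z : T} (hz : z ∈ B.map (pullbackRing M D).subtype) :
    (b : T) ∣ a * z := by
  have hle : B.map (pullbackRing M D).subtype ≤
      Submodule.comap (LinearMap.mulLeft T (a : T)) (Ideal.span {(b : T)}) := by
    rw [Ideal.map_le_iff_le_comap]
    intro j hj
    obtain ⟨d, hd⟩ := h j hj
    exact Ideal.mem_span_singleton.mpr ⟨d, congrArg Subtype.val hd⟩
  exact Ideal.mem_span_singleton.mp (hle hz)

/-- For `s ∈ M`, the `T`-ideal `s B` is generated by finitely many elements of `R`. -/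
theorem exists_fg_map_subtype_eq {B : Ideal T} (hB : B.FG) {s : T} (hs : s ∈ M) :
    ∃ A : Ideal (pullbackRing M D), A.FG ∧
      A.map (pullbackRing M D).subtype = Ideal.span {s} * B := by
  obtain ⟨S, rfl⟩ := hB
  refine ⟨Ideal.span ((fun b : T => (⟨s * b, mem_pullbackRing_of_mem (M.mul_mem_right b hs)⟩ :
    pullbackRing M D)) '' (S : Set T)), Submodule.fg_span (S.finite_toSet.image _), ?_⟩
  rw [Ideal.map_span, Set.image_image, Ideal.span_mul_span']
  simp [Set.singleton_mul]

/-- The ideal `{x ∈ T | x M ⊆ P}`. -/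
def extension (P : Ideal (pullbackRing M D)) : Ideal T where
  carrier := {x | ∀ m (hm : m ∈ M),
    (⟨x * m, mem_pullbackRing_of_mem (M.mul_mem_left x hm)⟩ : pullbackRing M D) ∈ P}
  zero_mem' m hm := by
    convert zero_mem P
    simp
  add_mem' {x y} hx hy m hm := by
    convert add_mem (hx m hm) (hy m hm)
    simp [add_mul]
  smul_mem' t x hx m hm := by
    convert hx (t * m) (M.mul_mem_left t hm) using 2
    simp only [smul_eq_mul]
    ring

theorem coe_mem_extension {P : Ideal (pullbackRing M D)} {p : pullbackRing M D} (hp : p ∈ P) :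
    (p : T) ∈ extension P :=
  fun m hm => P.mul_mem_right ⟨m, mem_pullbackRing_of_mem hm⟩ hp

theorem map_subtype_le_extension (P : Ideal (pullbackRing M D)) :
    P.map (pullbackRing M D).subtype ≤ extension P :=
  Ideal.map_le_iff_le_comap.mpr fun _ hp => coe_mem_extension hp

theorem mem_extension_of_mul_mem {P : Ideal (pullbackRing M D)} [P.IsPrime]
    {s : pullbackRing M D} (hs : s ∉ P) {x : T} {p : pullbackRing M D} (hp : p ∈ P)
    (h : (p : T) = s * x) : x ∈ extension P := by
  intro m hm
  refine (‹P.IsPrime›.mem_or_mem (x := s) ?_).resolve_left hs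
  convert P.mul_mem_right ⟨m, mem_pullbackRing_of_mem hm⟩ hp using 1
  apply Subtype.ext
  simp [h, mul_assoc]

theorem comap_extension {P : Ideal (pullbackRing M D)} [P.IsPrime]
    (h : ¬ RingHom.ker (pullbackMap M D) ≤ P) :
    (extension P).comap (pullbackRing M D).subtype = P := by
  refine le_antisymm (fun x hx => ?_) fun p hp => coe_mem_extension hp
  obtain ⟨s, hs, hsP⟩ := SetLike.not_le_iff_exists.mp h
  exact (‹P.IsPrime›.mem_or_mem (hx s (mem_ker_pullbackMap.mp hs))).resolve_right hsP

theorem extension_ne_top {P : Ideal (pullbackRing M D)} [P.IsPrime]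
    (h : ¬ RingHom.ker (pullbackMap M D) ≤ P) : extension P ≠ ⊤ := fun hT =>
  ‹P.IsPrime›.ne_top (by rw [← comap_extension h, hT, Ideal.comap_top])

theorem le_extension {N : Ideal T} {P : Ideal (pullbackRing M D)}
    (h : N.comap (pullbackRing M D).subtype ≤ P) : N ≤ extension P :=
  fun _ hx m _ => h (N.mul_mem_right m hx)

theorem map_subtype_ne_bot {B : Ideal (pullbackRing M D)} (hB : B ≠ ⊥) :
    B.map (pullbackRing M D).subtype ≠ ⊥ := fun h =>
  hB ((Ideal.map_eq_bot_iff_of_injective Subtype.val_injective).mp h)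

/-! ### t-ideals under contraction from T and extension to T -/

section Domain

variable [IsDomain T]

/-- Applies the definition to the fraction y = (s y)/s, so that multipliers may be taken from T. -/
theorem mul_mem_of_divisorialMem {B : Ideal (pullbackRing M D)} {x : pullbackRing M D}
    (hx : DivisorialMem B x) {y : T} {s : pullbackRing M D} (hs : s ≠ 0)
    (hsy : (s : T) * y ∈ pullbackRing M D) (hy : ∀ j ∈ B, y * j ∈ pullbackRing M D) :
    y * x ∈ pullbackRing M D := by
  obtain ⟨d, hd⟩ := hx ⟨s * y, hsy⟩ s hs fun j hj =>
    pullbackRing_dvd (hy j hj) (mul_assoc _ _ _)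
  have hd' : (s : T) * y * x = s * d := congrArg Subtype.val hd
  have hs' : (s : T) ≠ 0 := fun h => hs (Subtype.ext h)
  rw [mul_assoc] at hd'
  rw [mul_left_cancel₀ hs' hd']
  exact d.2

theorem isTIdeal_comap_subtype {N : Ideal T} [N.IsPrime] (hN : IsTIdeal N) (h : ¬ M ≤ N) :
    IsTIdeal (N.comap (pullbackRing M D).subtype) := by
  obtain ⟨s, hs, hsN⟩ := SetLike.not_le_iff_exists.mp h
  have hs0 : s ≠ 0 := fun h => hsN (h ▸ zero_mem N)
  rw [isTIdeal_iff]
  refine ⟨fun h0 => ?_, fun B hB fB nB x hx => ?_⟩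
  · obtain ⟨n, hn, hn0⟩ := Submodule.exists_mem_ne_zero_of_ne_bot hN.1
    have : (⟨s * n, mem_pullbackRing_of_mem (M.mul_mem_right n hs)⟩ : pullbackRing M D) ∈
      N.comap (pullbackRing M D).subtype := N.mul_mem_left s hn
    rw [h0, Submodule.mem_bot] at this
    exact mul_ne_zero hs0 hn0 (congrArg Subtype.val this)
  · refine (‹N.IsPrime›.mem_or_mem (x := s) (hN.mem (Ideal.map_le_iff_le_comap.mpr hB)
      (Ideal.FG.map fB _) (map_subtype_ne_bot nB) ?_)).resolve_left hsN
    intro a b hb hj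
    -- The fraction a/b over T is rewritten as s²a/(sb), whose numerator and denominator lie in M ⊆
    -- R; the second factor s makes the quotients s d lie in R.
    obtain ⟨e, he⟩ := hx ⟨s * (s * a), mem_pullbackRing_of_mem (M.mul_mem_right _ hs)⟩
      ⟨s * b, mem_pullbackRing_of_mem (M.mul_mem_right _ hs)⟩
      (fun h => mul_ne_zero hs0 hb (congrArg Subtype.val h)) fun j hjB => by
        obtain ⟨d, hd⟩ := hj j (Ideal.mem_map_of_mem (pullbackRing M D).subtype hjB)
        refine pullbackRing_dvd (y := s * d) (mem_pullbackRing_of_mem (M.mul_mem_right _ hs)) ?_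
        simp only [Subring.coe_mul]
        linear_combination s * s * hd
    have he' : s * (s * a) * x = s * b * e := congrArg Subtype.val he
    refine ⟨e, mul_left_cancel₀ hs0 ?_⟩
    simp only [Subring.subtype_apply]
    linear_combination he'

theorem isTIdeal_extension {P : Ideal (pullbackRing M D)} [P.IsPrime] (hP : IsTIdeal P)
    (h : ¬ RingHom.ker (pullbackMap M D) ≤ P) : IsTIdeal (extension P) := by
  obtain ⟨s, hs, hsP⟩ := SetLike.not_le_iff_exists.mp h
  rw [mem_ker_pullbackMap] at hs
  have hs0 : (s : T) ≠ 0 := fun h => hsP ((Subtype.ext h : s = 0) ▸ zero_mem P)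
  rw [isTIdeal_iff]
  refine ⟨fun h0 => ?_, fun B hB fB nB x hx => ?_⟩
  · exact map_subtype_ne_bot hP.1 (le_bot_iff.mp (h0 ▸ map_subtype_le_extension P))
  -- Since A generates sB in T, x ∈ B^v gives s²x ∈ A^v: one s comes from A, the other brings the
  -- quotient back into R. Then s² ∉ P is cancelled.
  obtain ⟨A, fA, hA⟩ := exists_fg_map_subtype_eq (D := D) fB hs
  refine mem_extension_of_mul_mem (P := P) (s := s * s)
    (p := ⟨(s : T) * (s * x), mem_pullbackRing_of_mem (M.mul_mem_right _ hs)⟩)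
    (fun h => hsP ((or_self_iff).mp (‹P.IsPrime›.mem_or_mem h))) (hP.mem (B := A) ?_ fA ?_ ?_)
    (by simp [mul_assoc])
  · intro z hz
    have hz' := Ideal.mem_map_of_mem (pullbackRing M D).subtype hz
    rw [hA, Ideal.mem_span_singleton_mul] at hz'
    obtain ⟨j, hj, hjz⟩ := hz'
    convert hB hj s hs using 1
    exact Subtype.ext (hjz.symm.trans (mul_comm _ _))
  · rintro rfl
    rw [Ideal.map_bot, eq_comm, ← Ideal.zero_eq_bot, mul_eq_zero] at hA
    rcases hA with hA | hA
    · exact hs0 (by simpa using hA)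
    · exact nB hA
  · intro a b hb hj
    obtain ⟨d, hd⟩ := hx (a * s) b (fun h => hb (Subtype.ext h)) fun j hjB => by
      have := dvd_mul_of_mem_map hj (z := s * j)
        (hA ▸ Ideal.mul_mem_mul (Ideal.mem_span_singleton_self _) hjB)
      rwa [← mul_assoc] at this
    refine pullbackRing_dvd (y := s * d) (mem_pullbackRing_of_mem (M.mul_mem_right _ hs)) ?_
    simp only [Subring.coe_mul]
    linear_combination (s : T) * hd

end Domain

theorem ne_bot_of_not_ker_le {P : Ideal (pullbackRing M D)}
    (h : ¬ RingHom.ker (pullbackMap M D) ≤ P) : M ≠ ⊥ := by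
  rintro rfl
  refine h fun x hx => ?_
  rw [(Subtype.ext (by simpa using mem_ker_pullbackMap.mp hx) : x = 0)]
  exact zero_mem P

/-! ### The two families of maximal t-ideals of R -/

section Maximal

variable [M.IsMaximal]

theorem not_le_of_not_le {N : Ideal T} (hN : N ≠ ⊤) (h : ¬ N ≤ M) : ¬ M ≤ N := fun hle =>
  h (Ideal.IsMaximal.eq_of_le ‹M.IsMaximal› hN hle).ge

theorem exists_one_sub_mem {N : Ideal T} (h : ¬ N ≤ M) : ∃ m ∈ M, 1 - m ∈ N := by
  have := (Ideal.eq_top_iff_one _).mp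
    ((‹M.IsMaximal›.out.2 _ (right_lt_sup.mpr h)) : N ⊔ M = ⊤)
  obtain ⟨n, hn, m, hm, h1⟩ := Submodule.mem_sup.mp this
  exact ⟨m, hm, by rwa [← h1, add_sub_cancel_right]⟩

theorem exists_mul_add_eq_one {x : T} (hx : x ∉ M) : ∃ t, ∃ m ∈ M, x * t + m = 1 := by
  obtain ⟨y, i, hi, h⟩ := Ideal.IsMaximal.exists_inv ‹M.IsMaximal› hx
  exact ⟨y, i, hi, by rw [mul_comm, h]⟩

/-- A lift b ∉ M of a nonzero element is invertible mod M. Adjoining m = 1 - bt ∈ M makes the lift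
generate T without changing its image in D. -/
theorem exists_fg_map_eq_of_ne_bot {C : Ideal D} (hC : C.FG) (h0 : C ≠ ⊥) :
    ∃ B : Ideal (pullbackRing M D), B.FG ∧ B.map (pullbackMap M D) = C ∧
      B.map (pullbackRing M D).subtype = ⊤ := by
  obtain ⟨B, fB, rfl⟩ := exists_fg_map_eq hC
  obtain ⟨b, hb, hbM⟩ : ∃ b ∈ B, (b : T) ∉ M := by
    by_contra! h
    refine h0 (le_bot_iff.mp (Ideal.map_le_iff_le_comap.mpr fun b hb => ?_))
    exact mem_ker_pullbackMap.mpr (h b hb)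
  obtain ⟨t, m, hm, h1⟩ := exists_mul_add_eq_one hbM
  set m' : pullbackRing M D := ⟨m, mem_pullbackRing_of_mem hm⟩
  have hm0 : pullbackMap M D m' = 0 := pullbackMap_eq_zero_iff.mpr hm
  refine ⟨B ⊔ Ideal.span {m'}, Submodule.FG.sup fB (Submodule.fg_span_singleton _), ?_, ?_⟩
  · rw [Ideal.map_sup, Ideal.map_span, Set.image_singleton, hm0]
    simp
  · rw [Ideal.eq_top_iff_one, ← h1]
    refine add_mem (Ideal.mul_mem_right _ _ ?_) ?_
    · exact Ideal.mem_map_of_mem (pullbackRing M D).subtype (le_sup_left (a := B) hb)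
    · exact Ideal.mem_map_of_mem (pullbackRing M D).subtype
        (le_sup_right (a := B) (Ideal.mem_span_singleton_self m'))

variable [IsDomain T]

/-- Every element of T multiplies B ⊆ M into R. So x ∈ B^v satisfies T x ⊆ R, and if x ∉ M, being a
unit mod M, it would force D = k. -/
theorem isTIdeal_ker_pullbackMap (hD : D ≠ ⊤) (hM : M ≠ ⊥) :
    IsTIdeal (RingHom.ker (pullbackMap M D)) := by
  obtain ⟨s, hs, hs0⟩ := Submodule.exists_mem_ne_zero_of_ne_bot hM
  rw [isTIdeal_iff]
  refine ⟨fun h => hs0 ?_, fun B hB _ _ x hx => ?_⟩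
  · have : (⟨s, mem_pullbackRing_of_mem hs⟩ : pullbackRing M D) ∈
        RingHom.ker (pullbackMap M D) := mem_ker_pullbackMap.mpr hs
    rw [h, Submodule.mem_bot] at this
    exact congrArg Subtype.val this
  · rw [mem_ker_pullbackMap]
    by_contra hxM
    refine hD ((Subring.eq_top_iff' D).mpr fun z => ?_)
    obtain ⟨w, rfl⟩ := Ideal.Quotient.mk_surjective z
    obtain ⟨t, m, hm, h1⟩ := exists_mul_add_eq_one hxM
    have key : w * t * x ∈ pullbackRing M D :=
      mul_mem_of_divisorialMem hx (s := ⟨s, mem_pullbackRing_of_mem hs⟩)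
        (fun h => hs0 (congrArg Subtype.val h))
        (mem_pullbackRing_of_mem (M.mul_mem_right _ hs))
        fun j hj => mem_pullbackRing_of_mem (M.mul_mem_left _ (mem_ker_pullbackMap.mp (hB hj)))
    rw [Subring.mem_comap] at key
    convert key using 1
    rw [Ideal.Quotient.eq]
    convert M.mul_mem_left w hm using 1
    linear_combination (-w) * h1

theorem isTIdeal_comap_pullbackMap (hD : D ≠ ⊤) {Q : Ideal D} (hQ : IsTIdeal Q) :
    IsTIdeal (Q.comap (pullbackMap M D)) := by
  rw [isTIdeal_iff]
  refine ⟨fun h => ?_, fun B hB fB nB x hx => ?_⟩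
  · refine hQ.1 ?_
    rw [← Ideal.map_comap_of_surjective _ pullbackMap_surjective Q, h, Ideal.map_bot]
  by_cases hker : B ≤ RingHom.ker (pullbackMap M D)
  · refine ker_le_comap Q ((isTIdeal_ker_pullbackMap hD ?_).mem hker fB nB hx)
    rintro rfl
    exact nB (le_bot_iff.mp fun b hb =>
      Subtype.ext (by simpa using mem_ker_pullbackMap.mp (hker hb)))
  · refine hQ.mem (Ideal.map_le_iff_le_comap.mpr hB) (Ideal.FG.map fB _)
      (fun h => hker (Ideal.map_le_iff_le_comap.mp h.le)) ?_
    intro α β hβ h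
    obtain ⟨a, rfl⟩ := pullbackMap_surjective α
    obtain ⟨b, rfl⟩ := pullbackMap_surjective β
    have hbM : (b : T) ∉ M := fun h => hβ (pullbackMap_eq_zero_iff.mpr h)
    obtain ⟨t, m, hm, h1⟩ := exists_mul_add_eq_one hbM
    have hbt : Ideal.Quotient.mk M (b : T) * Ideal.Quotient.mk M t = 1 := by
      rw [← map_mul, ← map_one (Ideal.Quotient.mk M), Ideal.Quotient.eq, ← h1]
      simpa using hm
    -- The element a t of T represents α/β in k and multiplies B into R.
    have key : (a : T) * t * x ∈ pullbackRing M D := by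
      refine mul_mem_of_divisorialMem hx (s := b) (fun h => hβ (by rw [h, map_zero])) ?_ ?_
      · have : (b : T) * (a * t) = a * (1 - m) := by linear_combination (a : T) * h1
        rw [this]
        exact mul_mem a.2 (sub_mem (one_mem _) (mem_pullbackRing_of_mem hm))
      · intro j hj
        obtain ⟨δ, hδ⟩ := h _ (Ideal.mem_map_of_mem _ hj)
        have hδ' : Ideal.Quotient.mk M (a : T) * Ideal.Quotient.mk M (j : T) =
            Ideal.Quotient.mk M (b : T) * δ := congrArg Subtype.val hδ
        rw [Subring.mem_comap, map_mul, map_mul]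
        convert δ.2 using 1
        linear_combination (Ideal.Quotient.mk M t) * hδ' + (δ : T ⧸ M) * hbt
    refine ⟨⟨_, key⟩, Subtype.ext ?_⟩
    change Ideal.Quotient.mk M (a : T) * Ideal.Quotient.mk M (x : T) =
      Ideal.Quotient.mk M (b : T) * Ideal.Quotient.mk M (a * t * x : T)
    rw [map_mul, map_mul]
    linear_combination (-Ideal.Quotient.mk M (a : T) * Ideal.Quotient.mk M (x : T)) * hbt

theorem isTIdeal_map_pullbackMap {P : Ideal (pullbackRing M D)} (hP : IsTIdeal P)
    (hker : RingHom.ker (pullbackMap M D) < P) : IsTIdeal (P.map (pullbackMap M D)) := by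
  rw [isTIdeal_iff]
  refine ⟨fun h => hker.not_ge (Ideal.map_le_iff_le_comap.mp h.le), fun C hC fC nC ξ hξ => ?_⟩
  obtain ⟨B, fB, rfl, hBT⟩ := exists_fg_map_eq_of_ne_bot fC nC
  obtain ⟨x, rfl⟩ := pullbackMap_surjective ξ
  refine Ideal.mem_map_of_mem _ (hP.mem (B := B) ?_ fB ?_ ?_)
  · rw [← comap_map_pullbackMap hker.le]
    exact Ideal.map_le_iff_le_comap.mp hC
  · rintro rfl
    exact nC Ideal.map_bot
  · intro a b hb h
    -- As B generates T, the fraction a/b is an element y of T and can be reduced mod M.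
    obtain ⟨y, hy⟩ : (b : T) ∣ a := by
      simpa using dvd_mul_of_mem_map h (z := 1) (hBT ▸ Submodule.mem_top)
    have hb' : (b : T) ≠ 0 := fun h => hb (Subtype.ext h)
    have hyj : ∀ j ∈ B, y * j ∈ pullbackRing M D := by
      intro j hj
      obtain ⟨d, hd⟩ := h j hj
      have hd' : (a : T) * j = b * d := congrArg Subtype.val hd
      rw [hy, mul_assoc] at hd'
      rw [mul_left_cancel₀ hb' hd']
      exact d.2
    obtain ⟨j₀, hj₀, hj₀M⟩ : ∃ b ∈ B, pullbackMap M D b ≠ 0 := by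
      by_contra! h
      exact nC (le_bot_iff.mp (Ideal.map_le_iff_le_comap.mpr h))
    -- The residue of y need not lie in D; it is written as a fraction over D with denominator the
    -- image of j₀.
    obtain ⟨δ, hδ⟩ := hξ (pullbackMap M D ⟨y * j₀, hyj j₀ hj₀⟩) (pullbackMap M D j₀) hj₀M (by
      intro γ hγ
      obtain ⟨j, hj, rfl⟩ := (Ideal.mem_map_iff_of_surjective _ pullbackMap_surjective).mp hγ
      rw [← map_mul]
      refine map_dvd _ (pullbackRing_dvd (hyj j hj) ?_)
      simp only [Subring.coe_mul]
      ring)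
    have hδ' : Ideal.Quotient.mk M (y * j₀ : T) * Ideal.Quotient.mk M (x : T) =
      Ideal.Quotient.mk M (j₀ : T) * δ := congrArg Subtype.val hδ
    have hj₀' : Ideal.Quotient.mk M (j₀ : T) ≠ 0 := fun h => hj₀M (Subtype.ext h)
    refine pullbackRing_dvd (y := y * x) ?_ (by simp only [Subring.coe_mul, hy]; ring)
    rw [Subring.mem_comap]
    convert δ.2 using 1
    apply mul_left_cancel₀ hj₀'
    rw [← hδ', ← map_mul, ← map_mul]
    congr 1
    ring

theorem IsMaximalTIdeal.comap_pullbackMap (hD : D ≠ ⊤) {Q : Ideal D} (hQ : IsMaximalTIdeal Q) :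
    IsMaximalTIdeal (Q.comap (pullbackMap M D)) := by
  have hlt : RingHom.ker (pullbackMap M D) < Q.comap (pullbackMap M D) := by
    refine (ker_le_comap Q).lt_of_not_ge fun h => hQ.1.1.1 (le_bot_iff.mp ?_)
    rw [← Ideal.map_comap_of_surjective _ pullbackMap_surjective Q, Ideal.map_le_iff_le_comap]
    exact h
  refine ⟨⟨isTIdeal_comap_pullbackMap hD hQ.1.1, fun h => hQ.1.2 ?_⟩, fun P hP hle => ?_⟩
  · exact (Ideal.comap_eq_top_iff).mp h
  · have hlt' := hlt.trans_le hle
    rw [← comap_map_pullbackMap hlt'.le]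
    refine Ideal.comap_mono (hQ.2 ⟨isTIdeal_map_pullbackMap hP.1 hlt', fun h => hP.2 ?_⟩ ?_)
    · rw [← comap_map_pullbackMap hlt'.le, h, Ideal.comap_top]
    · rw [← Ideal.map_comap_of_surjective _ pullbackMap_surjective Q]
      exact Ideal.map_mono hle

theorem IsMaximalTIdeal.map_pullbackMap (hD : D ≠ ⊤) {P : Ideal (pullbackRing M D)}
    (hP : IsMaximalTIdeal P) (hlt : RingHom.ker (pullbackMap M D) < P) :
    IsMaximalTIdeal (P.map (pullbackMap M D)) := by
  refine ⟨⟨isTIdeal_map_pullbackMap hP.1.1 hlt, fun h => hP.1.2 ?_⟩, fun Q hQ hle => ?_⟩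
  · rw [← comap_map_pullbackMap hlt.le, h, Ideal.comap_top]
  · have := hP.2 ⟨isTIdeal_comap_pullbackMap hD hQ.1, fun h => hQ.2 (Ideal.comap_eq_top_iff.mp h)⟩
      (Ideal.map_le_iff_le_comap.mp hle)
    rw [← Ideal.map_comap_of_surjective _ pullbackMap_surjective Q]
    exact Ideal.map_mono this

theorem exists_isMaximalTIdeal_of_not_isField {A : Type*} [CommRing A] [IsDomain A]
    (hA : ¬ IsField A) : ∃ Q : Ideal A, IsMaximalTIdeal Q := by
  obtain ⟨d, hd0, hd⟩ := Ring.exists_not_isUnit_of_not_isField hA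
  obtain ⟨Q, hQ, -⟩ := (isTIdeal_span_singleton hd0).exists_le_isMaximalTIdeal
    fun h => hd (Ideal.span_singleton_eq_top.mp h)
  exact ⟨Q, hQ⟩

/-- A maximal t-ideal of D exists and is nonzero, so its preimage is a proper t-ideal strictly
larger than the kernel. -/
theorem IsMaximalTIdeal.ker_lt (hD : D ≠ ⊤) (hF : ¬ IsField D) {P : Ideal (pullbackRing M D)}
    (hP : IsMaximalTIdeal P) (hle : RingHom.ker (pullbackMap M D) ≤ P) :
    RingHom.ker (pullbackMap M D) < P := by
  refine lt_of_le_of_ne hle fun h => ?_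
  obtain ⟨Q, hQ⟩ := exists_isMaximalTIdeal_of_not_isField hF
  have hQ' := hQ.comap_pullbackMap hD (M := M)
  have := hP.eq_of_le hQ'.1.1 hQ'.1.2 (h ▸ ker_le_comap Q)
  refine hQ.1.1.1 ?_
  rw [← Ideal.map_comap_of_surjective _ pullbackMap_surjective Q, ← this, ← h]
  exact le_bot_iff.mp (Ideal.map_le_iff_le_comap.mpr le_rfl)

theorem IsMaximalTIdeal.comap_subtype {N : Ideal T} (hN : IsMaximalTIdeal N) (h : ¬ N ≤ M) :
    IsMaximalTIdeal (N.comap (pullbackRing M D).subtype) := by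
  have := hN.isPrime
  have ht := isTIdeal_comap_subtype (D := D) hN.1.1 (not_le_of_not_le hN.1.2 h)
  refine ⟨⟨ht, Ideal.comap_ne_top _ hN.1.2⟩, fun I hI hle => ?_⟩
  obtain ⟨P, hP, hIP⟩ := hI.1.exists_le_isMaximalTIdeal hI.2
  have hPp := hP.isPrime
  refine hIP.trans fun p hp => ?_
  -- Since 1 - m ∈ N ∩ R ⊆ P, P cannot contain the kernel, so its extension is a proper t-ideal over
  -- N and equals N.
  obtain ⟨m, hm, hmN⟩ := exists_one_sub_mem h
  have hker : ¬ RingHom.ker (pullbackMap M D) ≤ P := by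
    intro hker
    have h1 : (1 - ⟨m, mem_pullbackRing_of_mem hm⟩ : pullbackRing M D) ∈ P := hIP (hle hmN)
    have h2 : (⟨m, mem_pullbackRing_of_mem hm⟩ : pullbackRing M D) ∈ P :=
      hker (mem_ker_pullbackMap.mpr hm)
    exact hP.1.2 ((Ideal.eq_top_iff_one _).mpr (by simpa using add_mem h1 h2))
  rw [hN.eq_of_le (isTIdeal_extension hP.1.1 hker) (extension_ne_top hker)
    (le_extension (hle.trans hIP))]
  exact coe_mem_extension hp

theorem IsMaximalTIdeal.not_le_ker (hD : D ≠ ⊤) {P : Ideal (pullbackRing M D)}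
    (hP : IsMaximalTIdeal P) (h : ¬ RingHom.ker (pullbackMap M D) ≤ P) :
    ¬ P ≤ RingHom.ker (pullbackMap M D) := fun hle =>
  h (hP.eq_of_le (isTIdeal_ker_pullbackMap hD (ne_bot_of_not_ker_le h))
    (RingHom.ker_ne_top _) hle).ge

theorem IsMaximalTIdeal.not_extension_le (hD : D ≠ ⊤) {P : Ideal (pullbackRing M D)}
    (hP : IsMaximalTIdeal P) (h : ¬ RingHom.ker (pullbackMap M D) ≤ P) :
    ¬ extension P ≤ M := fun hle =>
  hP.not_le_ker hD h fun _ hp => mem_ker_pullbackMap.mpr (hle (coe_mem_extension hp))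

theorem IsMaximalTIdeal.isMaximalTIdeal_extension (hD : D ≠ ⊤) {P : Ideal (pullbackRing M D)}
    (hP : IsMaximalTIdeal P) (h : ¬ RingHom.ker (pullbackMap M D) ≤ P) :
    IsMaximalTIdeal (extension P) := by
  have := hP.isPrime
  refine ⟨⟨isTIdeal_extension hP.1.1 h, extension_ne_top h⟩, fun I hI hle => ?_⟩
  obtain ⟨N, hN, hIN⟩ := hI.1.exists_le_isMaximalTIdeal hI.2
  have hNM : ¬ N ≤ M := fun hNM => hP.not_extension_le hD h (hle.trans (hIN.trans hNM))
  have hN' := hN.comap_subtype (D := D) hNM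
  have := hP.eq_of_le hN'.1.1 hN'.1.2 fun p hp => (hle.trans hIN) (coe_mem_extension hp)
  exact hIN.trans (le_extension this.ge)

end Maximal

end Pullback

/-! ### Transfer of t-super potency -/

section Potency

variable {T : Type*} [CommRing T] [IsDomain T] {M : Ideal T} [M.IsMaximal] {D : Subring (T ⧸ M)}

theorem IsMaximalTIdeal.isTSuperPotentIdeal_of_comap_subtype {N : Ideal T}
    (hN : IsMaximalTIdeal N) (hNM : ¬ N ≤ M)
    (h : IsTSuperPotentIdeal (N.comap (pullbackRing M D).subtype))
    (hex : ∃ Q : Ideal (pullbackRing M D), IsMaximalTIdeal Q ∧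
      RingHom.ker (pullbackMap M D) ≤ Q) :
    IsTSuperPotentIdeal N := by
  have hNp := hN.isPrime
  obtain ⟨hP, I, hIP, hI0, fI, huniq, hJ⟩ := isTSuperPotentIdeal_iff.mp h
  obtain ⟨m, hm, hmN⟩ := SetLike.not_le_iff_exists.mp (not_le_of_not_le hN.1.2 hNM)
  refine isTSuperPotentIdeal_iff.mpr ⟨hN, I.map (pullbackRing M D).subtype,
    Ideal.map_le_iff_le_comap.mpr hIP, map_subtype_ne_bot hI0, Ideal.FG.map fI _, ?_, ?_⟩
  · intro N' hN' hle
    have hle' := Ideal.map_le_iff_le_comap.mp hle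
    by_cases hN'M : N' ≤ M
    -- If N' ⊆ M, then I lies in the kernel, hence in Q. Uniqueness gives Q = N ∩ R, which would
    -- contain M.
    · obtain ⟨Q, hQ, hkerQ⟩ := hex
      have hIQ : I ≤ Q := fun i hi => hkerQ (mem_ker_pullbackMap.mpr (hN'M (hle' hi)))
      rw [huniq Q hQ hIQ] at hkerQ
      exact absurd (hkerQ (mem_ker_pullbackMap.mpr hm) :
        (⟨m, mem_pullbackRing_of_mem hm⟩ : pullbackRing M D) ∈
          N.comap (pullbackRing M D).subtype) hmN
    · have := huniq _ (hN'.comap_subtype hN'M) hle'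
      refine hN'.eq_of_le hN.1.1 hN.1.2 fun x hx => ?_
      have hxm : (⟨x * m, mem_pullbackRing_of_mem (M.mul_mem_left x hm)⟩ : pullbackRing M D) ∈
        N'.comap (pullbackRing M D).subtype := N'.mul_mem_right m hx
      rw [this] at hxm
      exact (hNp.mem_or_mem (show x * m ∈ N from hxm)).resolve_right hmN
  · intro J fJ hle
    obtain ⟨A, fA, hA⟩ := exists_fg_map_subtype_eq (D := D) fJ hm
    obtain ⟨c, hc, u, hu, hdvd⟩ := hJ (A ⊔ I) (Submodule.FG.sup fA fI) le_sup_right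
    have hsup : (A ⊔ I).map (pullbackRing M D).subtype ≤ J := by
      rw [Ideal.map_sup, hA]
      exact sup_le Ideal.mul_le_right hle
    refine ⟨c, hsup (Ideal.mem_map_of_mem _ hc), m * u,
      fun h => (hNp.mem_or_mem h).elim hmN hu, fun j hj => ?_⟩
    have := dvd_mul_of_mem_map hdvd (z := m * j) (Ideal.map_mono le_sup_left
      (hA ▸ Ideal.mul_mem_mul (Ideal.mem_span_singleton_self m) hj))
    rwa [mul_left_comm, ← mul_assoc] at this

theorem IsMaximalTIdeal.isTSuperPotentIdeal_comap_subtype {N : Ideal T}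
    (hN : IsMaximalTIdeal N) (hNM : ¬ N ≤ M) (h : IsTSuperPotentIdeal N) :
    IsTSuperPotentIdeal (N.comap (pullbackRing M D).subtype) := by
  have hNp := hN.isPrime
  obtain ⟨-, I, hIN, hI0, fI, huniq, hJ⟩ := isTSuperPotentIdeal_iff.mp h
  obtain ⟨m, hm, h1m⟩ := exists_one_sub_mem hNM
  have hmN : m ∉ N := fun h => hN.1.2 ((Ideal.eq_top_iff_one N).mpr (by simpa using add_mem h1m h))
  have hm0 : m ≠ 0 := fun h => hmN (h ▸ zero_mem N)
  obtain ⟨A, fA, hA⟩ := exists_fg_map_subtype_eq (D := D) fI hm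
  have hmA : ∀ i ∈ I, m * i ∈ A.map (pullbackRing M D).subtype := fun i hi =>
    hA ▸ Ideal.mul_mem_mul (Ideal.mem_span_singleton_self m) hi
  set m' : pullbackRing M D := ⟨m, mem_pullbackRing_of_mem hm⟩ with hm'
  -- The generator 1 - m' excludes all maximal t-ideals containing the kernel; A carries I into R,
  -- as it generates mI in T.
  refine isTSuperPotentIdeal_iff.mpr ⟨hN.comap_subtype hNM, A ⊔ Ideal.span {1 - m'}, ?_, ?_,
    Submodule.FG.sup fA (Submodule.fg_span_singleton _), ?_, ?_⟩
  · refine sup_le (Ideal.map_le_iff_le_comap.mp (hA ▸ Ideal.mul_le_right.trans hIN)) ?_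
    exact (Ideal.span_singleton_le_iff_mem _).mpr h1m
  · intro h
    obtain ⟨i, hi, hi0⟩ := Submodule.exists_mem_ne_zero_of_ne_bot hI0
    have := hmA i hi
    rw [(sup_eq_bot_iff.mp h).1, Ideal.map_bot, Submodule.mem_bot] at this
    exact mul_ne_zero hm0 hi0 this
  · intro P hP hle
    have hPp := hP.isPrime
    have h1P : 1 - m' ∈ P := hle (le_sup_right (a := A) (Ideal.mem_span_singleton_self _))
    have hmP : m' ∉ P := fun h =>
      hP.1.2 ((Ideal.eq_top_iff_one P).mpr (by simpa using add_mem h1P h))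
    have hker : ¬ RingHom.ker (pullbackMap M D) ≤ P := fun h =>
      hmP (h (mem_ker_pullbackMap.mpr hm))
    have hAP : A.map (pullbackRing M D).subtype ≤ extension P :=
      (Ideal.map_mono (le_sup_left.trans hle)).trans (map_subtype_le_extension P)
    have hIE : I ≤ extension P := by
      intro i hi
      refine mem_extension_of_mul_mem (s := m' * m') (p := ⟨m * i * m,
        mem_pullbackRing_of_mem (M.mul_mem_left _ hm)⟩)
        (fun h => hmP (or_self_iff.mp (hPp.mem_or_mem h))) (hAP (hmA i hi) m hm) ?_
      simp only [Subring.coe_mul, hm']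
      ring
    have hPt := hP.1.1
    have hEt := isTIdeal_extension hPt hker
    obtain ⟨N', hN', hEN'⟩ := hEt.exists_le_isMaximalTIdeal (extension_ne_top hker)
    have hEq := huniq N' hN' (hIE.trans hEN')
    rw [hEq] at hEN'
    refine hP.eq_of_le (hN.comap_subtype hNM).1.1 (hN.comap_subtype hNM).1.2 ?_
    exact fun p hp => hEN' (coe_mem_extension hp)
  · intro J fJ hle
    have hL : I ≤ J.map (pullbackRing M D).subtype ⊔ I := le_sup_right
    obtain ⟨c, hc, u, hu, hdvd⟩ := hJ _ (Submodule.FG.sup (Ideal.FG.map fJ _) fI) hL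
    have hmc : m * c ∈ J.map (pullbackRing M D).subtype := by
      obtain ⟨x, hx, y, hy, rfl⟩ := Submodule.mem_sup.mp hc
      rw [mul_add]
      exact add_mem (Ideal.mul_mem_left _ _ hx)
        (Ideal.map_mono (le_sup_left.trans hle) (hmA y hy))
    -- One m moves c into JT, a second moves mc into J; the third in the multiplier m³u puts the
    -- quotient m d in R.
    refine ⟨_, map_subtype_le_extension J hmc m hm,
      ⟨m * (m * (m * u)), mem_pullbackRing_of_mem (M.mul_mem_right _ hm)⟩, ?_, fun j hj => ?_⟩
    · intro h
      have h : m * (m * (m * u)) ∈ N := h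
      simp [hNp.mul_mem_iff_mem_or_mem, hmN, hu] at h
    · obtain ⟨d, hd⟩ := hdvd j (le_sup_left (b := I) (Ideal.mem_map_of_mem _ hj))
      refine pullbackRing_dvd (y := m * d) (mem_pullbackRing_of_mem (M.mul_mem_right _ hm)) ?_
      simp only [Subring.coe_mul]
      linear_combination m * m * m * hd

theorem IsMaximalTIdeal.isTSuperPotentIdeal_of_comap_pullbackMap (hD : D ≠ ⊤) {Q : Ideal D}
    (hQ : IsMaximalTIdeal Q) (h : IsTSuperPotentIdeal (Q.comap (pullbackMap M D))) :
    IsTSuperPotentIdeal Q := by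
  obtain ⟨hP, I, hIP, hI0, fI, huniq, hJ⟩ := isTSuperPotentIdeal_iff.mp h
  obtain ⟨q, hq, hq0⟩ := Submodule.exists_mem_ne_zero_of_ne_bot hQ.1.1.1
  obtain ⟨d, rfl⟩ := pullbackMap_surjective q
  -- I may lie in the kernel; adjoining d makes its image nonzero.
  set I' := I ⊔ Ideal.span {d}
  have hd : d ∈ I' := le_sup_right (a := I) (Ideal.mem_span_singleton_self d)
  have fI' : I'.FG := Submodule.FG.sup fI (Submodule.fg_span_singleton d)
  refine isTSuperPotentIdeal_iff.mpr ⟨hQ, I'.map (pullbackMap M D),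
    Ideal.map_le_iff_le_comap.mpr (sup_le hIP ((Ideal.span_singleton_le_iff_mem _).mpr hq)),
    fun h => hq0 ?_, Ideal.FG.map fI' _, fun Q' hQ' hle => ?_, fun J fJ hle => ?_⟩
  · simpa [h] using Ideal.mem_map_of_mem (pullbackMap M D) hd
  · have := huniq _ (hQ'.comap_pullbackMap hD) (le_sup_left.trans (Ideal.map_le_iff_le_comap.mp hle))
    exact Ideal.comap_injective_of_surjective _ pullbackMap_surjective this
  · obtain ⟨B, fB, rfl⟩ := exists_fg_map_eq fJ
    obtain ⟨c, hc, u, hu, hdvd⟩ := hJ (B ⊔ I') (Submodule.FG.sup fB fI')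
      (le_sup_left.trans le_sup_right)
    have hmap : (B ⊔ I').map (pullbackMap M D) = B.map (pullbackMap M D) := by
      rw [Ideal.map_sup, sup_eq_left]
      exact hle
    refine ⟨pullbackMap M D c, hmap ▸ Ideal.mem_map_of_mem _ hc, pullbackMap M D u, hu,
      fun j hj => ?_⟩
    obtain ⟨b, hb, rfl⟩ := (Ideal.mem_map_iff_of_surjective _ pullbackMap_surjective).mp hj
    rw [← map_mul]
    exact map_dvd _ (hdvd b (le_sup_left (b := I') hb))

theorem IsMaximalTIdeal.isTSuperPotentIdeal_comap_pullbackMap (hD : D ≠ ⊤)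
    (hF : ¬ IsField D) {Q : Ideal D}
    (hQ : IsMaximalTIdeal Q) (h : IsTSuperPotentIdeal Q) :
    IsTSuperPotentIdeal (Q.comap (pullbackMap M D)) := by
  have hPp := (hQ.comap_pullbackMap hD).isPrime
  obtain ⟨-, C, hCQ, hC0, fC, huniq, hJ⟩ := isTSuperPotentIdeal_iff.mp h
  obtain ⟨I, fI, rfl, hIT⟩ := exists_fg_map_eq_of_ne_bot fC hC0
  refine isTSuperPotentIdeal_iff.mpr ⟨hQ.comap_pullbackMap hD, I,
    Ideal.map_le_iff_le_comap.mp hCQ, ?_, fI, fun P hP hle => ?_, fun J fJ hle => ?_⟩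
  · rintro rfl
    exact hC0 Ideal.map_bot
  · have hPp' := hP.isPrime
    have hker : RingHom.ker (pullbackMap M D) ≤ P := by
      by_contra hker
      -- Since I generates T, a prime containing I but not the kernel would have the whole of T as
      -- extension.
      refine extension_ne_top hker (top_le_iff.mp ?_)
      rw [← hIT]
      exact (Ideal.map_mono hle).trans (map_subtype_le_extension P)
    have hlt := hP.ker_lt hD hF hker
    rw [← huniq _ (hP.map_pullbackMap hD hlt) (Ideal.map_mono hle), comap_map_pullbackMap hker]
  · obtain ⟨γ, hγ, σ, hσ, hdvd⟩ := hJ _ (Ideal.FG.map fJ _) (Ideal.map_mono hle)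
    obtain ⟨c, hc, rfl⟩ := (Ideal.mem_map_iff_of_surjective _ pullbackMap_surjective).mp hγ
    obtain ⟨s, rfl⟩ := pullbackMap_surjective σ
    have hcM : (c : T) ∉ M := by
      intro hcM
      rw [pullbackMap_eq_zero_iff.mpr hcM] at hdvd
      refine hC0 (le_bot_iff.mp fun x hx => ?_)
      have := zero_dvd_iff.mp (hdvd x (Ideal.map_mono hle hx))
      refine (mul_eq_zero.mp this).resolve_left fun h0 => hσ (h0 ▸ zero_mem Q)
    obtain ⟨t, m, hm, h1⟩ := exists_mul_add_eq_one hcM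
    set m' : pullbackRing M D := ⟨m, mem_pullbackRing_of_mem hm⟩
    have hm' : pullbackMap M D m' = 0 := pullbackMap_eq_zero_iff.mpr hm
    -- Here 1 - m = c t, so multiplying by it absorbs the error s j - c d ∈ M into a multiple of c;
    -- its image in D is 1.
    refine ⟨c, hc, (1 - m') * s, fun h => hσ ?_, fun j hj => ?_⟩
    · simpa [hm'] using h
    · obtain ⟨δ, hδ⟩ := hdvd _ (Ideal.mem_map_of_mem _ hj)
      obtain ⟨d, rfl⟩ := pullbackMap_surjective δ
      have hmem : (s * j - c * d : T) ∈ M := by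
        rw [← map_mul, ← map_mul, ← sub_eq_zero, ← map_sub, pullbackMap_eq_zero_iff] at hδ
        exact hδ
      refine pullbackRing_dvd (y := (1 - m) * d + t * (s * j - c * d)) (add_mem
        (mul_mem (sub_mem (one_mem _) m'.2) d.2)
        (mem_pullbackRing_of_mem (M.mul_mem_left t hmem))) ?_
      change (1 - m) * s * j = _
      linear_combination (-(s * j - c * d : T)) * h1

theorem not_isField_of_isTSuperPotentDomain (hD : D ≠ ⊤) (hMD : M ≠ ⊥ ∨ ¬ IsField D)
    (h : IsTSuperPotentDomain (pullbackRing M D)) : ¬ IsField D := by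
  intro hF
  have hM : M ≠ ⊥ := hMD.resolve_right (not_not_intro hF)
  have hmax : IsMaximalTIdeal (RingHom.ker (pullbackMap M D)) := by
    let := hF.toField
    have : (RingHom.ker (pullbackMap M D)).IsMaximal :=
      RingHom.ker_isMaximal_of_surjective _ pullbackMap_surjective
    exact ⟨⟨isTIdeal_ker_pullbackMap hD hM, RingHom.ker_ne_top _⟩, fun P hP hle =>
      (this.eq_of_le hP.2 hle).ge⟩
  obtain ⟨-, I, hIM, hI0, fI, -, hJ⟩ := isTSuperPotentIdeal_iff.mp (h _ hmax)
  obtain ⟨c, hc, s, hs, hdvd⟩ := hJ I fI le_rfl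
  have hcM := mem_ker_pullbackMap.mp (hIM hc)
  have hs0 : s ≠ 0 := fun h0 => hs (h0 ▸ zero_mem _)
  have hc0 : (c : T) ≠ 0 := by
    intro h0
    obtain ⟨i, hi, hi0⟩ := Submodule.exists_mem_ne_zero_of_ne_bot hI0
    have := hdvd i hi
    rw [(Subtype.ext h0 : c = 0), zero_dvd_iff] at this
    exact mul_ne_zero hs0 hi0 this
  refine hD ((Subring.eq_top_iff' D).mpr fun z => ?_)
  obtain ⟨x, rfl⟩ := Ideal.Quotient.mk_surjective z
  -- With c' = i + r x c generating I + (xc) at M, dividing s'c = c'w and s'xc = c'v by each other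
  -- gives x w = v. As w is a unit mod M and D is a field, x mod M lies in D.
  set xc : pullbackRing M D := ⟨x * c, mem_pullbackRing_of_mem (M.mul_mem_left x hcM)⟩ with hxc
  obtain ⟨c', hc', s', hs', hdvd'⟩ := hJ (I ⊔ Ideal.span {xc})
    (Submodule.FG.sup fI (Submodule.fg_span_singleton _)) le_sup_left
  obtain ⟨i, hi, y, hy, rfl⟩ := Submodule.mem_sup.mp hc'
  obtain ⟨r, rfl⟩ := Ideal.mem_span_singleton'.mp hy
  obtain ⟨e, he⟩ := hdvd i hi
  obtain ⟨w, hw⟩ := hdvd' c (le_sup_left (b := Ideal.span {xc}) hc)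
  obtain ⟨v, hv⟩ := hdvd' xc (le_sup_right (a := I) (Ideal.mem_span_singleton_self xc))
  have he' : (s * i : T) = c * e := congrArg Subtype.val he
  have hw' : (s' * c : T) = (i + r * (x * c)) * w := congrArg Subtype.val hw
  have hv' : (s' * (x * c) : T) = (i + r * (x * c)) * v := congrArg Subtype.val hv
  have hw2 : (s * s' : T) = (e + s * r * x) * w := by
    apply mul_left_cancel₀ hc0
    linear_combination (s : T) * hw' + (w : T) * he'
  have hv2 : (s * s' * x : T) = (e + s * r * x) * v := by
    apply mul_left_cancel₀ hc0
    linear_combination (s : T) * hv' + (v : T) * he'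
  have hss : (s * s' : T) ∉ M := fun hmem =>
    (‹M.IsMaximal›.isPrime.mem_or_mem hmem).elim (fun h => hs (mem_ker_pullbackMap.mpr h))
      fun h => hs' (mem_ker_pullbackMap.mpr h)
  have hwM : (w : T) ∉ M := fun h => hss (hw2 ▸ M.mul_mem_left _ h)
  have heM : (e + s * r * x : T) ∉ M := fun h => hss (hw2 ▸ M.mul_mem_right _ h)
  obtain ⟨ω, hω⟩ := hF.mul_inv_cancel
    (fun h => hwM (pullbackMap_eq_zero_iff.mp h) : pullbackMap M D w ≠ 0)
  have hω' : Ideal.Quotient.mk M (w : T) * (ω : T ⧸ M) = 1 := congrArg Subtype.val hω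
  have hxw : Ideal.Quotient.mk M x * Ideal.Quotient.mk M (w : T) =
      Ideal.Quotient.mk M (v : T) := by
    rw [← map_mul]
    congr 1
    refine mul_left_cancel₀ (fun h => heM (h ▸ zero_mem M) : (e + s * r * x : T) ≠ 0) ?_
    linear_combination (-x) * hw2 + hv2
  have : Ideal.Quotient.mk M x = ((pullbackMap M D v * ω : D) : T ⧸ M) := by
    change _ = Ideal.Quotient.mk M (v : T) * (ω : T ⧸ M)
    linear_combination (-Ideal.Quotient.mk M x) * hω' + (ω : T ⧸ M) * hxw
  rw [this]
  exact SetLike.coe_mem _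

end Potency

end TOperation

theorem theorem4p4 {T : Type*} [CommRing T] [IsDomain T] (M : Ideal T) [M.IsMaximal]
    (D : Subring (T ⧸ M)) (hD : D ≠ ⊤)
    (hMD : M ≠ ⊥ ∨ ¬ IsField D) :
    TOperation.IsTSuperPotentDomain (pullbackRing M D) ↔
      (TOperation.IsTSuperPotentDomain D ∧ ¬ IsField D) ∧
        ∀ N : Ideal T, TOperation.IsMaximalTIdeal N → ¬ N ≤ M →
          TOperation.IsTSuperPotentIdeal N := by
  open TOperation in
  constructor
  · intro h
    have hF := not_isField_of_isTSuperPotentDomain hD hMD h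
    refine ⟨⟨fun Q hQ => ?_, hF⟩, fun N hN hNM => ?_⟩
    · exact hQ.isTSuperPotentIdeal_of_comap_pullbackMap hD (h _ (hQ.comap_pullbackMap hD))
    · obtain ⟨Q, hQ⟩ := exists_isMaximalTIdeal_of_not_isField hF
      exact hN.isTSuperPotentIdeal_of_comap_subtype hNM (h _ (hN.comap_subtype hNM))
        ⟨_, hQ.comap_pullbackMap hD, ker_le_comap Q⟩
  · rintro ⟨⟨hDsp, hF⟩, hT⟩ P hP
    have hPp := hP.isPrime
    by_cases hker : RingHom.ker (pullbackMap M D) ≤ P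
    · have hQ := hP.map_pullbackMap hD (hP.ker_lt hD hF hker)
      rw [← comap_map_pullbackMap hker]
      exact hQ.isTSuperPotentIdeal_comap_pullbackMap hD hF (hDsp _ hQ)
    · have hN := hP.isMaximalTIdeal_extension hD hker
      have hNM := hP.not_extension_le hD hker
      rw [← comap_extension hker]
      exact hN.isTSuperPotentIdeal_comap_subtype hNM (hT _ hN hNM)
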